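/- Let $K$ be a global function field of odd characteristic with full (finite) field of constants $\mathbb{F}_q$, let $X$ be its set of places, $K_{\mathfrak p}$ the completion of $K$ at $\mathfrak p$, $[\mathfrak p]\in\operatorname{Pic}X$ the class of $\mathfrak p$, and $\mathcal L(\mathcal D)=\{x\in K^\times : \operatorname{div} x\ge -\mathcal D\}\cup\{0\}$. For $x\in K^\times$ put $\left(\frac{x}{\mathfrak p}\right)=1$ if $x$ is a square in $K_{\mathfrak p}$, $0$ if $\operatorname{ord}_{\mathfrak p}x$ is odd, and $-1$ otherwise. For $S\subseteq X$, call $x\in K^\times$ $S$-singular if $\operatorname{ord}_{\mathfrak q}x$ is even for all $\mathfrak q\in X\setminus S$, and let $\mathrm{Sing}=\{x\in K^\times: x \text{ is } \emptyset\text{-singular}\}/(K^{\times})^2$. Let $\beta_1,\dots,\beta_n\in K^\times$ represent an $\mathbb{F}_2$-basis of $\mathrm{Sing}$, and let $\mathfrak B=\{\mathfrak b_1,\dots,\mathfrak b_n\}\subset X$ be compatible with it, i.e. $\left(\frac{\beta_i}{\mathfrak b_i}\right)=-1$ and $\left(\frac{\beta_i}{\mathfrak b_j}\right)=1$ for $i\ne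 j$. Let $\mathfrak B'=\{\mathfrak b_{n+1},\dots,\mathfrak b_m\}\subset X$ ($m\ge n$) be disjoint from $\mathfrak B$ and such that the classes of the places of $\mathfrak B\cup\mathfrak B'$ generate $\operatorname{Pic}X$ (with $\mathfrak b_1,\dots,\mathfrak b_m$ pairwise distinct). Let $\mathfrak S'=\{\mathfrak s_1,\dots,\mathfrak s_s\}\subset X$ be a finite set disjoint from $\mathfrak B\cup\mathfrak B'$ whose classes are linearly independent in $\operatorname{Pic}X/2\operatorname{Pic}X$, and let $\mathfrak p\in X\setminus(\mathfrak S'\cup\mathfrak B)$ be a place whose class modulo $2\operatorname{Pic}X$ lies in the $\mathbb{F}_2$-span of the classes of $\mathfrak s_1,\dots,\mathfrak s_s$. Then there are $\varepsilon_1,\dots,\varepsilon_s\in\{0,1\}$ with $[\mathfrak p]\equiv\sum_i\varepsilon_i[\mathfrak s_i]\pmod{2\operatorname{Pic}X}$. For any such $\varepsilon_i$, let $\mathfrak t_1,\dots,\mathfrak t_t$ be the distinct elements of $\{\mathfrak s_i : \varepsilon_i=1\}$, for $v=(v_0,\dots,v_{t+m})\in\mathbb{Z}^{1+t+m}$ let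 $$\mathcal D_v=v_0\mathfrak p+\sum_{i=1}^{t}v_i\mathfrak t_i+\sum_{i=1}^{m}2v_{t+i}\mathfrak b_i ,$$ and let $\psi:\mathbb{Z}^{1+t+m}\to\operatorname{Pic}X$, $\psi(v)=v_0[\mathfrak p]+\sum_{i=1}^t v_i[\mathfrak t_i]+\sum_{i=1}^m 2v_{t+i}[\mathfrak b_i]$. Then: 1. $\ker\psi$ contains a vector $v$ with $v_0$ odd. 2. For every $v\in\ker\psi$ with $v_0$ odd, $\dim_{\mathbb{F}_q}\mathcal L(\mathcal D_v)=1$. For every generator $\lambda$ of $\mathcal L(\mathcal D_v)$ there are (necessarily unique) $e_1,\dots,e_n\in\{0,1\}$ with $(-1)^{e_i}=\left(\frac{\lambda}{\mathfrak b_i}\right)$ for $1\le i\le n$, and the element $\lambda_{\mathfrak p}=\lambda\prod_{i=1}^n\beta_i^{e_i}$ is $(\mathfrak S'\cup\{\mathfrak p\})$-singular, satisfies $\operatorname{ord}_{\mathfrak p}\lambda_{\mathfrak p}\equiv1\pmod 2$, and $\left(\frac{\lambda_{\mathfrak p}}{\mathfrak b}\right)=1$ for every $\mathfrak b\in\mathfrak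 B$. -/

import Mathlib

noncomputable section

namespace SingularElements

/-! ### Places, valuations, the quadratic symbol -/

/-- The points of the smooth complete curve `X` attached to a global function field `K`, i.e. the
equivalence classes of discrete valuations of `K`. A class is given by its valuation ring, a
discrete valuation ring with field of fractions `K`. (The field of constants is finite, so every
valuation of `K` is trivial on it.) -/
def Place (K : Type*) [Field K] : Type _ :=
  {O : ValuationSubring K // IsDiscreteValuationRing O}

variable {K : Type*} [Field K]

namespace Place

instance (P : Place K) : IsDiscreteValuationRing P.1 := P.2

/-- The maximal ideal of the valuation ring of the place. -/
def prime (P : Place K) : IsDedekindDomain.HeightOneSpectrum P.1 :=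
  IsDiscreteValuationRing.maximalIdeal P.1

/-- The normalized valuation `ord_P` with values in `ℤ`. It is meaningful for `x ≠ 0`; the value
at `0` is `0` by convention. -/
def ord (P : Place K) (x : K) : ℤ := -WithZero.log (P.prime.valuation K x)

theorem val_ne_zero (P : Place K) {x : K} (hx : x ≠ 0) : P.prime.valuation K x ≠ 0 :=
  (Valuation.ne_zero_iff _).2 hx

@[simp] theorem ord_one (P : Place K) : P.ord 1 = 0 := by simp [ord]

theorem ord_mul (P : Place K) {x y : K} (hx : x ≠ 0) (hy : y ≠ 0) :
    P.ord (x * y) = P.ord x + P.ord y := by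
  simp only [ord, map_mul, WithZero.log_mul (P.val_ne_zero hx) (P.val_ne_zero hy)]
  ring

theorem ord_inv (P : Place K) (x : K) : P.ord x⁻¹ = -P.ord x := by
  simp [ord, map_inv₀, WithZero.log_inv]

theorem ord_pow (P : Place K) (x : K) (k : ℕ) : P.ord (x ^ k) = k * P.ord x := by
  simp [ord, map_pow, WithZero.log_pow]

theorem min_ord_le_ord_add (P : Place K) {x y : K} (hx : x ≠ 0) (hy : y ≠ 0) (hxy : x + y ≠ 0) :
    min (P.ord x) (P.ord y) ≤ P.ord (x + y) := by
  have h := (P.prime.valuation K).map_add x y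
  rcases le_max_iff.1 h with h | h
  · have := (WithZero.log_le_log (P.val_ne_zero hxy) (P.val_ne_zero hx)).2 h
    exact (min_le_left _ _).trans (neg_le_neg this)
  · have := (WithZero.log_le_log (P.val_ne_zero hxy) (P.val_ne_zero hy)).2 h
    exact (min_le_right _ _).trans (neg_le_neg this)

/-- Constants from a finite field have valuation zero. -/
theorem ord_algebraMap {F : Type*} [Field F] [Finite F] [Algebra F K] (P : Place K) {c : F}
    (hc : c ≠ 0) : P.ord (algebraMap F K c) = 0 := by
  obtain ⟨k, hk, h⟩ := isOfFinOrder_iff_pow_eq_one.1 (isOfFinOrder_of_finite (Units.mk0 c hc))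
  have h1 : c ^ k = 1 := by simpa using congrArg Units.val h
  have h2 := P.ord_pow (algebraMap F K c) k
  rw [← map_pow, h1, map_one, ord_one] at h2
  rcases mul_eq_zero.1 h2.symm with h3 | h3
  · exact absurd (Int.natCast_eq_zero.1 h3) hk.ne'
  · exact h3

open Classical in
/-- The generalized Legendre symbol `(x / P)` of `x ∈ Kˣ`: it is `1` if `x` is a square in the
completion `K_P`, `0` if `ord_P x` is odd, and `-1` if `ord_P x` is even but `x` is not a square
in `K_P`. -/
def legendre (P : Place K) (x : Kˣ) : ℤ :=
  if IsSquare (algebraMap K (P.prime.adicCompletion K) (x : K)) then 1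
  else if Odd (P.ord (x : K)) then 0
  else -1

end Place

/-! ### Divisors, the Picard group, Riemann–Roch spaces -/

/-- The group of divisors of `X`. -/
abbrev Divisor (K : Type*) [Field K] : Type _ := Place K →₀ ℤ

variable (K) in
/-- The group of principal divisors `div x = ∑ ord_P x · P`, for `x ∈ Kˣ`. -/
def principalDivisors : AddSubgroup (Divisor K) where
  carrier := {D | ∃ x : Kˣ, ∀ P : Place K, D P = P.ord (x : K)}
  zero_mem' := ⟨1, fun P => by simp⟩
  add_mem' := by
    rintro D E ⟨x, hx⟩ ⟨y, hy⟩
    exact ⟨x * y, fun P => by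
      rw [Finsupp.add_apply, hx, hy, Units.val_mul, P.ord_mul x.ne_zero y.ne_zero]⟩
  neg_mem' := by
    rintro D ⟨x, hx⟩
    exact ⟨x⁻¹, fun P => by rw [Finsupp.neg_apply, hx, Units.val_inv_eq_inv_val, P.ord_inv]⟩

variable (K) in
/-- The Picard group of `X`: divisors modulo principal divisors. -/
def Pic : Type _ := Divisor K ⧸ principalDivisors K

instance : AddCommGroup (Pic K) :=
  inferInstanceAs (AddCommGroup (Divisor K ⧸ principalDivisors K))

/-- The class of a divisor in the Picard group. -/
def divClass : Divisor K →+ Pic K := QuotientAddGroup.mk' (principalDivisors K)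

/-- The class `[P]` of a place in the Picard group. -/
def Place.cls (P : Place K) : Pic K := divClass (Finsupp.single P 1)

/-- The coset `[P] + 2 Pic X` in the `𝔽₂`-vector space `Pic X / 2 Pic X`. -/
def Place.clsModTwo (P : Place K) : ModN (Pic K) 2 := ModN.mkQ 2 P.cls

/-- The Riemann–Roch space `L(D) = {x ∈ K | x = 0 or div x ≥ -D}`, a vector space over the finite
field of constants. -/
def riemannRoch (F : Type*) [Field F] [Finite F] [Algebra F K] (D : Divisor K) :
    Submodule F K where
  carrier := {x | x ≠ 0 → ∀ P : Place K, -D P ≤ P.ord x}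
  zero_mem' := fun h => absurd rfl h
  add_mem' := by
    intro x y hx hy hxy P
    by_cases hx0 : x = 0
    · subst hx0
      rw [zero_add] at hxy ⊢
      exact hy hxy P
    by_cases hy0 : y = 0
    · subst hy0
      rw [add_zero] at hxy ⊢
      exact hx hxy P
    exact (le_min (hx hx0 P) (hy hy0 P)).trans (P.min_ord_le_ord_add hx0 hy0 hxy)
  smul_mem' := by
    intro c x hx hcx P
    rw [Algebra.smul_def] at hcx ⊢
    have hc : algebraMap F K c ≠ 0 := left_ne_zero_of_mul hcx
    have hx0 : x ≠ 0 := right_ne_zero_of_mul hcx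
    have hc0 : c ≠ 0 := fun h => hc (by rw [h, map_zero])
    rw [P.ord_mul hc hx0, P.ord_algebraMap hc0, zero_add]
    exact hx hx0 P

/-! ### Singular elements -/

/-- The group of `S`-singular elements of `Kˣ`: those with even valuations everywhere
outside `S`. -/
def singularUnits (S : Set (Place K)) : Subgroup Kˣ where
  carrier := {x | ∀ P : Place K, P ∉ S → Even (P.ord (x : K))}
  one_mem' := fun P _ => by simp
  mul_mem' := by
    intro x y hx hy P hP
    rw [Units.val_mul, P.ord_mul x.ne_zero y.ne_zero]
    exact (hx P hP).add (hy P hP)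
  inv_mem' := by
    intro x hx P hP
    rw [Units.val_inv_eq_inv_val, P.ord_inv]
    exact (hx P hP).neg

/-- The square class of `x` in `Kˣ / (Kˣ)²`; the latter is written additively, as an
`𝔽₂`-vector space. -/
def sqClass (x : Kˣ) : ModN (Additive Kˣ) 2 := ModN.mkQ 2 (Additive.ofMul x)

/-- The group of square classes of `S`-singular elements, as a subspace of the `𝔽₂`-vector space
`Kˣ / (Kˣ)²`. -/
def singularClasses (S : Set (Place K)) : Submodule (ZMod 2) (ModN (Additive Kˣ) 2) :=
  AddSubgroup.toZModSubmodule 2 ((Subgroup.toAddSubgroup (singularUnits S)).map (ModN.mkQ 2))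

/-- The square classes of `β₁, …, βₙ` form a basis of the group of singular elements modulo
squares. -/
def IsSingularBasis {n : ℕ} (β : Fin n → Kˣ) : Prop :=
  LinearIndependent (ZMod 2) (fun i => sqClass (β i)) ∧
    Submodule.span (ZMod 2) (Set.range fun i => sqClass (β i)) = singularClasses (∅ : Set (Place K))

/-- Compatibility of `{β₁, …, βₙ}` and `{𝔟₁, …, 𝔟ₙ}`: `(βᵢ / 𝔟ᵢ) = -1`, and `(βᵢ / 𝔟ⱼ) = 1` for
`i ≠ j`. -/
def Compatible {n : ℕ} (β : Fin n → Kˣ) (b : Fin n → Place K) : Prop :=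
  (∀ i, (b i).legendre (β i) = -1) ∧ ∀ i j, i ≠ j → (b j).legendre (β i) = 1

/-- `x` is a valid `λ_𝔭` with respect to `S'` and `B`: it is `(S' ∪ {𝔭})`-singular, of odd
valuation at `𝔭`, and `(x / 𝔟) = 1` for every `𝔟 ∈ B`. -/
def IsLambda (S' B : Set (Place K)) (p : Place K) (x : Kˣ) : Prop :=
  x ∈ singularUnits (S' ∪ {p}) ∧ p.ord (x : K) ≡ 1 [ZMOD 2] ∧ ∀ q ∈ B, q.legendre x = 1

/-! ### The lattice map and the divisor of the algorithm -/

section Lattice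

variable {t m : ℕ}

/-- The coordinate `v₀` of `v ∈ ℤ^{1+t+m}`. -/
def coordP (v : Fin (1 + t + m) → ℤ) : ℤ := v (Fin.castAdd m (Fin.castAdd t 0))

/-- The coordinates `v₁, …, v_t` of `v ∈ ℤ^{1+t+m}`. -/
def coordT (v : Fin (1 + t + m) → ℤ) (i : Fin t) : ℤ := v (Fin.castAdd m (Fin.natAdd 1 i))

/-- The coordinates `v_{t+1}, …, v_{t+m}` of `v ∈ ℤ^{1+t+m}`. -/
def coordB (v : Fin (1 + t + m) → ℤ) (i : Fin m) : ℤ := v (Fin.natAdd (1 + t) i)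

/-- `ψ(v) = v₀[𝔭] + ∑_{i ≤ t} vᵢ[𝔱ᵢ] + ∑_{i ≤ m} 2v_{t+i}[𝔟ᵢ]`. -/
def psi (p : Place K) (T : Fin t → Place K) (b : Fin m → Place K) :
    (Fin (1 + t + m) → ℤ) →ₗ[ℤ] Pic K where
  toFun v := coordP v • p.cls + ∑ i, coordT v i • (T i).cls + ∑ i, (2 * coordB v i) • (b i).cls
  map_add' v w := by
    simp only [coordP, coordT, coordB, Pi.add_apply, mul_add, add_smul, Finset.sum_add_distrib]
    abel
  map_smul' c v := by
    simp only [coordP, coordT, coordB, Pi.smul_apply, smul_eq_mul, RingHom.id_apply, smul_add,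
      Finset.smul_sum, smul_smul, mul_left_comm]

/-- The divisor `v₀𝔭 + ∑_{i ≤ t} vᵢ𝔱ᵢ + ∑_{i ≤ m} 2v_{t+i}𝔟ᵢ`. -/
def latticeDivisor (p : Place K) (T : Fin t → Place K) (b : Fin m → Place K)
    (v : Fin (1 + t + m) → ℤ) : Divisor K :=
  Finsupp.single p (coordP v) + ∑ i, Finsupp.single (T i) (coordT v i) +
    ∑ i, Finsupp.single (b i) (2 * coordB v i)

end Lattice

end SingularElements

end

open SingularElements

open SingularElements
open Polynomial

/-! ### Valuations of a function field over a finite constant field -/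

section FunctionField

variable {F K : Type*} [Field F] [Field K] [Algebra F K]

/-! If `ψ(v) = 0`, then `D_v` is the divisor of some `x`, and `L(D_v)` is the line spanned by `x⁻¹`:
for `y` in it, `y * x` has no poles, hence is constant (`riemannRoch_eq_span`). So every generator
`λ` has divisor `-D_v`, and its parities can be read off: even outside `S' ∪ {𝔭}`, odd at `𝔭`. The
`β i` have even order everywhere, so multiplying by them keeps these parities; by compatibility `β
i` corrects the symbol at `𝔟ᵢ` and disturbs no other place of `B` (`legendre_mul_prod_eq_one`). A
suitable `v` exists because `[𝔭] - ∑ [𝔱ᵢ]` is twice a class, and that class is a combination of the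
`[𝔟ᵢ]` (`exists_mem_ker_psi`).

Two facts about places carry the weight. First, a nonconstant element has a pole
(`exists_place_ord_neg`): some valuation ring omits it, and every such ring is shown to be discrete
because its value group has bounded exponent modulo a cyclic group. Second, a product of two local
nonsquares of even order is a local square (`isSquare_mul_of_legendre_eq_neg_one`): residue fields
are algebraic over the finite constants, and squares of odd residue characteristic lift to the
completion. -/

theorem Valuation.map_algebraMap_eq_one [Finite F] {Γ : Type*}
    [LinearOrderedCommGroupWithZero Γ] (v : Valuation K Γ) {c : F} (hc : c ≠ 0) :
    v (algebraMap F K c) = 1 := by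
  obtain ⟨k, hk, h⟩ := isOfFinOrder_iff_pow_eq_one.1 (isOfFinOrder_of_finite (Units.mk0 c hc))
  have h1 : c ^ k = 1 := by simpa using congrArg Units.val h
  refine (pow_eq_one_iff.1 ?_).resolve_right hk.ne'
  rw [← map_pow, ← map_pow, h1, map_one, map_one]

theorem Valuation.map_aeval_le_one [Finite F] {Γ : Type*}
    [LinearOrderedCommGroupWithZero Γ] (v : Valuation K Γ) {y : K} (hy : v y ≤ 1) (f : F[X]) :
    v (aeval y f) ≤ 1 := by
  rw [aeval_eq_sum_range]
  refine v.map_sum_le fun i _ => ?_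
  rw [Algebra.smul_def, map_mul, map_pow]
  refine mul_le_one' ?_ (pow_le_one' hy i)
  rcases eq_or_ne (f.coeff i) 0 with h | h
  · simp [h]
  · exact (v.map_algebraMap_eq_one h).le

theorem Valuation.map_aeval_eq_one [Finite F] {Γ : Type*}
    [LinearOrderedCommGroupWithZero Γ] (v : Valuation K Γ) {y : K} (hy : v y < 1) {f : F[X]}
    (hf : f.coeff 0 ≠ 0) : v (aeval y f) = 1 := by
  have h := congrArg (aeval y) (divX_mul_X_add f)
  rw [map_add, map_mul, aeval_X, aeval_C] at h
  rw [← h, v.map_add_eq_of_lt_right, v.map_algebraMap_eq_one hf]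
  rw [v.map_algebraMap_eq_one hf, map_mul]
  exact (mul_le_of_le_one_left' (v.map_aeval_le_one hy.le _)).trans_lt hy

/-- Split off the largest power of `X`; the cofactor has nonzero constant term, so its value at `y`
is a unit. -/
theorem Valuation.map_aeval_eq_pow [Finite F] {Γ : Type*}
    [LinearOrderedCommGroupWithZero Γ] (v : Valuation K Γ) {y : K} (hy : v y < 1) {f : F[X]}
    (hf : f ≠ 0) : ∃ k : ℕ, v (aeval y f) = v y ^ k := by
  obtain ⟨k, g, hg, hfg⟩ : ∃ (k : ℕ) (g : F[X]), g.coeff 0 ≠ 0 ∧ f = X ^ k * g := by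
    obtain ⟨g, hg⟩ := X_pow_dvd_iff.2 (fun d hd => coeff_eq_zero_of_lt_natTrailingDegree hd :
      ∀ d < f.natTrailingDegree, f.coeff d = 0)
    refine ⟨f.natTrailingDegree, g, ?_, hg⟩
    have := trailingCoeff_nonzero_iff_nonzero.2 hf
    rw [trailingCoeff] at this
    nth_rewrite 1 [hg] at this
    simpa [coeff_X_pow_mul'] using this
  exact ⟨k, by rw [hfg, map_mul, map_mul, v.map_aeval_eq_one hy hg, mul_one, map_pow, aeval_X,
    map_pow]⟩

theorem Valuation.transcendental_of_lt_one [Finite F] {Γ : Type*}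
    [LinearOrderedCommGroupWithZero Γ] (v : Valuation K Γ) {y : K} (hy : v y < 1) (hy0 : y ≠ 0) :
    Transcendental F y := by
  rintro ⟨f, hf, h⟩
  obtain ⟨k, hk⟩ := v.map_aeval_eq_pow hy hf
  rw [h, map_zero] at hk
  exact pow_ne_zero k (v.ne_zero_iff.2 hy0) hk.symm

variable [Algebra (RatFunc F) K] [IsScalarTower F (RatFunc F) K] [FunctionField F K]

variable (K) in
theorem FunctionField.trdeg_eq_one : Algebra.trdeg F K = 1 := by
  have h := lift_trdeg_add_eq F (RatFunc F) K
  have h' := trdeg_add_eq F F[X] (A := RatFunc F)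
  have h1 : Algebra.trdeg F[X] (RatFunc F) = 0 :=
    trdeg_eq_zero_iff.2
      (IsLocalization.isAlgebraic (R := F[X]) (S := RatFunc F) (nonZeroDivisors F[X]))
  have h2 : Algebra.trdeg (RatFunc F) K = 0 := trdeg_eq_zero_iff.2 inferInstance
  rw [h1, add_zero, Polynomial.trdeg_of_isDomain] at h'
  rw [h2, ← h'] at h
  simpa using h.symm

/-- In transcendence degree one, `y` alone is a transcendence basis, so `K` is algebraic over
`F(y)`; being finitely generated as a field, it is finite over it. -/
theorem FunctionField.finiteDimensional_adjoin {y : K} (hy : Transcendental F y) :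
    FiniteDimensional (IntermediateField.adjoin F {y}) K := by
  have hb : IsTranscendenceBasis F (fun _ : Unit => y) :=
    (algebraicIndependent_unique_type_iff.2 hy).isTranscendenceBasis_of_lift_trdeg_le_of_finite
      (by simp [FunctionField.trdeg_eq_one K])
  have halg := hb.isAlgebraic_field
  rw [Set.range_const] at halg
  have : Algebra.EssFiniteType F[X] (RatFunc F) := .of_isLocalization _ (nonZeroDivisors F[X])
  have : Algebra.EssFiniteType F (RatFunc F) := .comp F F[X] (RatFunc F)
  have : Algebra.EssFiniteType F K := .comp F (RatFunc F) K
  have : Algebra.EssFiniteType (IntermediateField.adjoin F {y}) K := .of_comp F _ K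
  obtain ⟨t, ht⟩ := IntermediateField.fg_top (IntermediateField.adjoin F {y}) K
  have : FiniteDimensional (IntermediateField.adjoin F {y})
      (IntermediateField.adjoin (IntermediateField.adjoin F {y}) (t : Set K)) :=
    IntermediateField.finiteDimensional_adjoin
      fun x _ => Algebra.IsIntegral.isIntegral x
  rw [ht] at this
  exact IntermediateField.topEquiv.toLinearEquiv.finiteDimensional

/-- With `d = [K : F(y)]`, the powers `1, x, …, x ^ d` are dependent over `F(y)`, hence over `F[y]`
after clearing denominators. The bound `d` does not depend on `x`. -/
theorem FunctionField.exists_relation {y : K} (hy : Transcendental F y) :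
    ∃ d : ℕ, ∀ x : K, ∃ a : Fin (d + 1) → F[X], a ≠ 0 ∧
      ∑ i, aeval y (a i) * x ^ (i : ℕ) = 0 := by
  have := FunctionField.finiteDimensional_adjoin hy
  open IntermediateField.algebraAdjoinAdjoin in
  refine ⟨Module.finrank (IntermediateField.adjoin F {y}) K, fun x => ?_⟩
  have h : ¬ LinearIndependent (IntermediateField.adjoin F {y})
      (fun i : Fin (Module.finrank (IntermediateField.adjoin F {y}) K + 1) => x ^ (i : ℕ)) := by
    intro h
    have := h.fintype_card_le_finrank
    simp at this
  open IntermediateField.algebraAdjoinAdjoin in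
  rw [← LinearIndependent.iff_fractionRing (Algebra.adjoin F {y}),
    Fintype.not_linearIndependent_iff] at h
  obtain ⟨g, hg, i, hi⟩ := h
  have hg' : ∀ i, ∃ f : F[X], aeval y f = (g i : K) := fun i =>
    (SetLike.ext_iff.1 (Algebra.adjoin_singleton_eq_range_aeval F y) _).1 (g i).2
  choose a ha using hg'
  refine ⟨a, fun h0 => hi ?_, ?_⟩
  · have := ha i
    rw [h0] at this
    exact Subtype.ext (by simpa using this.symm)
  · rw [← hg]
    exact Finset.sum_congr rfl fun i _ => by rw [ha]; rfl

/-- The value group of a valuation of a function field has bounded exponent modulo the subgroup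
generated by the value of any `y` with `v y < 1`. -/
theorem FunctionField.exists_valuation_pow_eq_zpow [Finite F] {Γ : Type*}
    [LinearOrderedCommGroupWithZero Γ] (v : Valuation K Γ) {y : K} (hy : v y < 1) (hy0 : y ≠ 0) :
    ∃ N : ℕ, N ≠ 0 ∧ ∀ x : K, x ≠ 0 → ∃ k : ℤ, v x ^ N = v y ^ k := by
  classical
  obtain ⟨d, hd⟩ := FunctionField.exists_relation (v.transcendental_of_lt_one (F := F) hy hy0)
  refine ⟨d.factorial, d.factorial_ne_zero, fun x hx => ?_⟩
  obtain ⟨a, ha, h⟩ := hd x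
  have hvx := v.ne_zero_iff.2 hx
  have hvy := v.ne_zero_iff.2 hy0
  have hne : (Finset.univ.filter fun i => a i ≠ 0).Nonempty := by
    obtain ⟨i, hi⟩ := Function.ne_iff.1 ha
    exact ⟨i, by simpa using hi⟩
  obtain ⟨i, hi, hmax⟩ := Finset.exists_max_image _
    (fun i => v (aeval y (a i) * x ^ (i : ℕ))) hne
  replace hi : a i ≠ 0 := by simpa using hi
  obtain ⟨k, hk⟩ := v.map_aeval_eq_pow hy hi
  -- A sum with a single term of largest value has that value and cannot vanish, so the maximum is
  -- attained twice.
  obtain ⟨j, hji, hj, hij⟩ : ∃ j, j ≠ i ∧ a j ≠ 0 ∧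
      v (aeval y (a j) * x ^ (j : ℕ)) = v (aeval y (a i) * x ^ (i : ℕ)) := by
    by_contra! hcon
    have hi0 : v (aeval y (a i) * x ^ (i : ℕ)) ≠ 0 := by
      rw [map_mul, hk, map_pow]
      exact mul_ne_zero (pow_ne_zero _ hvy) (pow_ne_zero _ hvx)
    refine hi0 ?_
    rw [← v.map_sum_eq_of_lt (s := Finset.univ) (f := fun i => aeval y (a i) * x ^ (i : ℕ))
      (Finset.mem_univ i), h, map_zero]
    · intro j hj
      have hji : j ≠ i := by simpa using hj
      by_cases hj0 : a j = 0
      · simpa [hj0, zero_lt_iff] using hi0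
      · exact lt_of_le_of_ne (hmax j (by simpa using hj0)) (hcon j hji hj0)
  obtain ⟨l, hl⟩ := v.map_aeval_eq_pow hy hj
  rw [map_mul, map_mul, hk, hl, map_pow, map_pow] at hij
  have key : v x ^ ((j : ℤ) - (i : ℤ)) = v y ^ ((k : ℤ) - (l : ℤ)) := by
    rw [zpow_sub₀ hvx, zpow_sub₀ hvy, div_eq_div_iff (zpow_ne_zero _ hvx) (zpow_ne_zero _ hvy)]
    simpa [mul_comm] using hij
  -- The exponent `j - i` varies with `x` but is nonzero of absolute value at most `d`; `d!` is a
  -- common multiple.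
  have hdvd : ((j : ℤ) - (i : ℤ)) ∣ d.factorial := by
    have h1 : ((j : ℤ) - (i : ℤ)).natAbs ∣ d.factorial :=
      Nat.dvd_factorial (by have := Fin.val_ne_of_ne hji; omega) (by omega)
    exact Int.natAbs_dvd.1 (Int.natCast_dvd_natCast.2 h1)
  obtain ⟨c, hc⟩ := hdvd
  refine ⟨((k : ℤ) - (l : ℤ)) * c, ?_⟩
  rw [← zpow_natCast, hc, zpow_mul, key, zpow_mul]

end FunctionField

/-! ### Squares in finite, algebraic and complete fields -/

section Squares

theorem FiniteField.isSquare_mul_of_not_isSquare {E : Type*} [Field E] [Finite E] {a b : E}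
    (ha : ¬ IsSquare a) (hb : ¬ IsSquare b) : IsSquare (a * b) := by
  classical
  cases nonempty_fintype E
  have ha0 : a ≠ 0 := fun h => ha (h ▸ IsSquare.zero)
  have hb0 : b ≠ 0 := fun h => hb (h ▸ IsSquare.zero)
  rw [← quadraticChar_one_iff_isSquare (mul_ne_zero ha0 hb0), map_mul,
    quadraticChar_neg_one_iff_not_isSquare.2 ha, quadraticChar_neg_one_iff_not_isSquare.2 hb]
  norm_num

/-- Both elements lie in a finite subfield, so algebraicity over `F` replaces finiteness of the
residue field. -/
theorem IsAlgebraic.isSquare_mul_of_not_isSquare {F k : Type*} [Field F] [Finite F] [Field k]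
    [Algebra F k] {a b : k} (ha : IsAlgebraic F a) (hb : IsAlgebraic F b)
    (ha' : ¬ IsSquare a) (hb' : ¬ IsSquare b) : IsSquare (a * b) := by
  let E := IntermediateField.adjoin F ({a, b} : Set k)
  have : FiniteDimensional F E := IntermediateField.finiteDimensional_adjoin (by
    rintro x (rfl | rfl)
    exacts [ha.isIntegral, hb.isIntegral])
  have : Finite E := Module.finite_of_finite F
  have haE : a ∈ E := IntermediateField.subset_adjoin _ _ (by simp)
  have hbE : b ∈ E := IntermediateField.subset_adjoin _ _ (by simp)
  have h := FiniteField.isSquare_mul_of_not_isSquare (a := (⟨a, haE⟩ : E)) (b := ⟨b, hbE⟩)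
    (fun h => ha' (h.map E.val)) (fun h => hb' (h.map E.val))
  exact h.map E.val

theorem Valued.nonarchimedeanAddGroup {R Γ : Type*} [Ring R]
    [LinearOrderedCommGroupWithZero Γ] [Valued R Γ] : NonarchimedeanAddGroup R where
  is_nonarchimedean U hU := by
    obtain ⟨γ, hγ⟩ := Valued.mem_nhds_zero.1 hU
    exact ⟨⟨Valued.v.restrict.ltAddSubgroup γ, AddSubgroup.isOpen_of_mem_nhds _
      (Valued.mem_nhds_zero.2 ⟨γ, subset_rfl⟩)⟩, hγ⟩

open Filter Topology in
/-- In a complete discretely valued field of odd characteristic, `1 + x` is a square if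
`v x < 1`: it is the square of the limit of `(1 + x) ^ ((p ^ k + 1) / 2)`. -/
theorem Valued.isSquare_of_v_sub_one_lt_one {L : Type*} [Field L]
    [Valued L (WithZero (Multiplicative ℤ))] [CompleteSpace L] [T2Space L] {p : ℕ}
    [Fact p.Prime] [CharP L p] (hp : p ≠ 2) {z : L}
    (hz : Valued.v (z - 1) < 1) : IsSquare z := by
  obtain ⟨r, hr⟩ := (Fact.out : p.Prime).odd_of_ne_two hp
  have hz1 : Valued.v z ≤ 1 := by
    have := Valued.v.map_add_le hz.le Valued.v.map_one.le
    rwa [sub_add_cancel] at this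
  have hpow : ∀ e : ℕ, Valued.v (z ^ e - 1) < 1 := fun e => by
    obtain ⟨c, hc⟩ : ∃ c, z ^ e - 1 = (z - 1) * c ∧ Valued.v c ≤ 1 :=
      ⟨∑ i ∈ Finset.range e, z ^ i, (mul_geom_sum z e).symm,
        Valued.v.map_sum_le fun i _ => by rw [map_pow]; exact pow_le_one' hz1 i⟩
    rw [hc.1, map_mul]
    exact (mul_le_of_le_one_right' hc.2).trans_lt hz
  have hlim : ∀ x : L, Valued.v x < 1 → Tendsto (fun k => x ^ p ^ k) atTop (𝓝 0) := fun x hx =>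
    (Valued.tendsto_zero_pow_of_v_lt_one hx).comp
      (tendsto_pow_atTop_atTop_of_one_lt (Fact.out : p.Prime).one_lt)
  -- This is `(p ^ k + 1) / 2` without division: as `p = 2 * r + 1`, consecutive values differ by `r
  -- * p ^ k`.
  let s : ℕ → ℕ := fun k => Nat.rec 1 (fun k c => c + r * p ^ k) k
  have hs : ∀ k, 2 * s k = p ^ k + 1 := fun k => by
    induction k with
    | zero => simp [s]
    | succ k ih =>
      change 2 * (s k + r * p ^ k) = _
      rw [mul_add, ih, pow_succ]
      nth_rewrite 4 [hr]
      ring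
  have hcauchy : CauchySeq fun k => z ^ s k := by
    have : NonarchimedeanAddGroup L := Valued.nonarchimedeanAddGroup
    refine NonarchimedeanAddGroup.cauchySeq_of_tendsto_sub_nhds_zero ?_
    have hd := hlim _ (hpow r)
    -- Frobenius turns `z ^ (r * p ^ k) - 1` into `(z ^ r - 1) ^ p ^ k`, which tends to zero.
    have heq : ∀ k, z ^ s (k + 1) - z ^ s k = z ^ s k * (z ^ r - 1) ^ p ^ k := fun k => by
      change z ^ (s k + r * p ^ k) - z ^ s k = _
      rw [sub_pow_char_pow, one_pow, pow_add, pow_mul]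
      ring
    simp_rw [heq]
    rw [tendsto_def] at hd ⊢
    intro U hU
    obtain ⟨γ, hγ⟩ := Valued.mem_nhds_zero.1 hU
    filter_upwards [hd _ (Valued.mem_nhds_zero.2 ⟨γ, subset_rfl⟩)] with k hk
    refine hγ ?_
    simp only [Set.mem_preimage, Set.mem_ofPred_eq] at hk ⊢
    refine lt_of_le_of_lt ?_ hk
    rw [map_mul]
    refine mul_le_of_le_one_left' ?_
    rw [map_pow]
    exact pow_le_one' (Valuation.restrict_le_one_iff _ |>.2 hz1) _
  obtain ⟨w, hw⟩ := cauchySeq_tendsto_of_complete hcauchy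
  refine ⟨w, ?_⟩
  have h1 : Tendsto (fun k => z ^ s k * z ^ s k) atTop (𝓝 z) := by
    have : ∀ k, z ^ s k * z ^ s k = z * (1 + (z - 1) ^ p ^ k) := fun k => by
      rw [← pow_add, ← two_mul, hs, sub_pow_char_pow, one_pow, pow_succ']
      ring
    simp_rw [this]
    simpa using ((hlim _ hz).const_add 1).const_mul z
  exact tendsto_nhds_unique h1 (hw.mul hw)

end Squares

/-! ### Discreteness of valuation rings and existence of poles -/

section Places

variable {K : Type*} [Field K]

/-- A valuation ring whose value group has bounded exponent modulo the subgroup generated by one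
value `v y < 1` is a discrete valuation ring. -/
theorem ValuationSubring.isDiscreteValuationRing_of_pow_eq_zpow (V : ValuationSubring K) {y : K}
    (hy : V.valuation y < 1) (hy0 : y ≠ 0) {N : ℕ} (hN : N ≠ 0)
    (h : ∀ x : K, x ≠ 0 → ∃ k : ℤ, V.valuation x ^ N = V.valuation y ^ k) :
    IsDiscreteValuationRing V := by
  have hvy : 0 < V.valuation y := zero_lt_iff.2 (V.valuation.ne_zero_iff.2 hy0)
  -- The exponent `k` is a homomorphism to `ℤ` whose sign decides membership in `V`; an element of
  -- least positive `k` will be the uniformizer.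
  choose k hk using fun x : Kˣ => h x x.ne_zero
  have hmul : ∀ x z, k (x * z) = k x + k z := fun x z =>
    zpow_right_injective₀ hvy hy.ne (by
      simp only
      rw [← hk, zpow_add₀ hvy.ne', ← hk, ← hk, Units.val_mul, map_mul, mul_pow])
  have hlt : ∀ x : Kˣ, V.valuation (x : K) < 1 ↔ 0 < k x := fun x => by
    rw [← zpow_lt_zpow_iff_right_of_lt_one₀ hvy hy, ← hk, zpow_zero, pow_lt_one_iff hN]
  have hle : ∀ x : Kˣ, V.valuation (x : K) ≤ 1 ↔ 0 ≤ k x := fun x => by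
    rw [← zpow_le_zpow_iff_right_of_lt_one₀ hvy hy, ← hk, zpow_zero, pow_le_one_iff hN]
  have hpow : ∀ (x : Kˣ) (n : ℕ), k (x ^ n) = n * k x := fun x n => by
    induction n with
    | zero =>
      have := hmul 1 1
      rw [mul_one] at this
      rw [pow_zero]
      push_cast
      linarith
    | succ n ih => rw [pow_succ, hmul, ih]; push_cast; ring
  classical
  have hex : ∃ n : ℕ, ∃ x : Kˣ, k x = n ∧ 0 < n := by
    have := (hlt (Units.mk0 y hy0)).1 hy
    exact ⟨(k (Units.mk0 y hy0)).toNat, Units.mk0 y hy0, by omega, by omega⟩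
  obtain ⟨π, hπ, hpos⟩ := Nat.find_spec hex
  have hmin : ∀ x : Kˣ, 0 < k x → k π ≤ k x := fun x hx => by
    have := Nat.find_min' hex (m := (k x).toNat) ⟨x, by omega, by omega⟩
    omega
  have hπ0 : 0 < k π := by omega
  have hunit : ∀ a : V, IsUnit a ↔ V.valuation (a : K) = 1 := V.valuation_eq_one_iff
  have hnon : ∀ (a : V) (ha : (a : K) ≠ 0), ¬ IsUnit a → 0 < k (Units.mk0 _ ha) := by
    intro a ha hu
    rw [← hlt]
    exact (V.valuation_lt_one_or_eq_one a).resolve_right fun h => hu ((hunit a).2 h)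
  let ϖ : V := ⟨π, (V.valuation_le_one_iff _).1 ((hle π).2 hπ0.le)⟩
  refine IsDiscreteValuationRing.ofHasUnitMulPowIrreducibleFactorization ⟨ϖ, ⟨?_, ?_⟩, ?_⟩
  · rw [hunit]
    exact ((hlt π).2 hπ0).ne
  · intro a b hab
    by_contra! hcon
    have hab' : (π : K) = a * b := congrArg Subtype.val hab
    have ha : (a : K) ≠ 0 := fun h => π.ne_zero (by rw [hab', h, zero_mul])
    have hb : (b : K) ≠ 0 := fun h => π.ne_zero (by rw [hab', h, mul_zero])
    have h1 := hmin _ (hnon a ha hcon.1)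
    have h2 := hnon b hb hcon.2
    have h3 : π = Units.mk0 _ ha * Units.mk0 _ hb := Units.ext hab'
    have h4 := congrArg k h3
    rw [hmul] at h4
    omega
  · intro x hx
    have hx0 : (x : K) ≠ 0 := fun h => hx (Subtype.ext h)
    set u : Kˣ := Units.mk0 _ hx0
    have hu0 : 0 ≤ k u := (hle u).1 (V.valuation_le_one x)
    set n := (k u / k π).toNat with hn
    have hn' : (n : ℤ) = k u / k π := Int.toNat_of_nonneg (Int.ediv_nonneg hu0 hπ0.le)
    set w : Kˣ := u * (π ^ n)⁻¹ with hw
    have huw : u = w * π ^ n := by rw [hw, inv_mul_cancel_right]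
    -- Division with remainder: `w` has exponent below `k π`, so minimality forces it to be a unit.
    have hkw : k w = k u % k π := by
      have := congrArg k huw
      rw [hmul, hpow, hn'] at this
      have := Int.emod_add_mul_ediv (k u) (k π)
      linarith [mul_comm (k u / k π) (k π)]
    have hkw0 : k w = 0 := by
      by_contra h0
      have h1 := Int.emod_nonneg (k u) hπ0.ne'
      have h2 := Int.emod_lt_of_pos (k u) hπ0
      have h3 := hmin w (by omega)
      omega
    have hvw : V.valuation (w : K) = 1 :=
      le_antisymm ((hle w).2 hkw0.ge) (not_lt.1 fun h => by have := (hlt w).1 h; omega)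
    have hwV : (w : K) ∈ V := (V.valuation_le_one_iff _).1 hvw.le
    have hwu : IsUnit (⟨w, hwV⟩ : V) := (hunit _).2 hvw
    refine ⟨n, hwu.unit, Subtype.ext ?_⟩
    have := congrArg Units.val huw
    rw [Units.val_mul, Units.val_pow_eq_pow_val] at this
    change (π : K) ^ n * (w : K) = x
    rw [mul_comm, ← this]
    rfl

namespace SingularElements

theorem Place.exp_neg_ord (P : Place K) {x : K} (hx : x ≠ 0) :
    WithZero.exp (-P.ord x) = P.prime.valuation K x := by
  rw [Place.ord, neg_neg, WithZero.exp_log (P.val_ne_zero hx)]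

theorem Place.ord_nonneg_iff (P : Place K) {x : K} (hx : x ≠ 0) : 0 ≤ P.ord x ↔ x ∈ P.1 := by
  have h : 0 ≤ P.ord x ↔ P.prime.valuation K x ≤ 1 := by
    rw [← P.exp_neg_ord hx, ← WithZero.exp_zero, WithZero.exp_le_exp, neg_nonpos]
  rw [h]
  constructor
  · intro h
    obtain ⟨a, rfl⟩ := IsDiscreteValuationRing.exists_lift_of_le_one h
    exact a.2
  · intro h
    exact P.prime.valuation_le_one (⟨x, h⟩ : P.1)

section FunctionField

variable {F : Type*} [Field F] [Finite F] [Algebra F K] [Algebra (RatFunc F) K]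
  [IsScalarTower F (RatFunc F) K] [FunctionField F K]

/-- A nonconstant element of a function field has a pole. -/
theorem exists_place_ord_neg (hF : algebraicClosure F K = ⊥) {x : K}
    (hx : x ∉ Set.range (algebraMap F K)) : ∃ P : Place K, P.ord x < 0 := by
  have hx0 : x ≠ 0 := fun h => hx ⟨0, by rw [h, map_zero]⟩
  have hxi : x ∉ (integralClosure F K).toSubring := fun h => hx (by
    have h1 : x ∈ algebraicClosure F K := mem_algebraicClosure_iff.2 (IsIntegral.isAlgebraic h)
    rw [hF] at h1
    exact IntermediateField.mem_bot.1 h1)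
  -- The integral closure of `F` is an intersection of valuation rings, so one of them omits `x`; it
  -- is not yet known to be discrete.
  obtain ⟨V, -, hV⟩ := Subring.exists_le_valuationSubring_of_isIntegrallyClosedIn hxi
  have hy : V.valuation x⁻¹ < 1 := by
    rw [← V.mem_nonunits_iff, V.inv_mem_nonunits_iff]
    exact .inr hV
  obtain ⟨N, hN, h⟩ := FunctionField.exists_valuation_pow_eq_zpow (F := F) V.valuation hy
    (inv_ne_zero hx0)
  let P : Place K := ⟨V, V.isDiscreteValuationRing_of_pow_eq_zpow hy (inv_ne_zero hx0) hN h⟩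
  refine ⟨P, not_le.1 fun h => hV ((P.ord_nonneg_iff hx0).1 h)⟩

end FunctionField

end SingularElements

end Places

/-! ### Residue fields and local squares -/

namespace SingularElements

variable {K : Type*} [Field K]

namespace Place

section FunctionField

variable (F : Type*) [Field F] [Finite F] [Algebra F K] [Algebra (RatFunc F) K]
  [IsScalarTower F (RatFunc F) K] [FunctionField F K]

/-- Elements of the valuation ring are algebraic over the constants modulo the maximal ideal. -/
theorem exists_valuation_aeval_lt_one (P : Place K) {x : K} (hx : P.prime.valuation K x ≤ 1) :
    ∃ f : F[X], f ≠ 0 ∧ P.prime.valuation K (aeval x f) < 1 := by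
  classical
  obtain ⟨y, hy⟩ := P.prime.valuation_exists_uniformizer K
  have hy1 : P.prime.valuation K y < 1 := by
    rw [hy, ← WithZero.exp_zero, WithZero.exp_lt_exp]
    norm_num
  have hy0 : y ≠ 0 := by
    rintro rfl
    rw [map_zero] at hy
    exact WithZero.exp_ne_zero hy.symm
  obtain ⟨d, hd⟩ := FunctionField.exists_relation
    ((P.prime.valuation K).transcendental_of_lt_one (F := F) hy1 hy0)
  obtain ⟨a, ha, h⟩ := hd x
  -- Cancel the largest common power of `y`, so that the relation survives reduction modulo `y`.
  obtain ⟨b, hb, i, hi⟩ : ∃ b : Fin (d + 1) → F[X],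
      ∑ i, aeval y (b i) * x ^ (i : ℕ) = 0 ∧ ∃ i, (b i).coeff 0 ≠ 0 := by
    obtain ⟨i, hi, hmin⟩ := Finset.exists_min_image (Finset.univ.filter fun i => a i ≠ 0)
      (fun i => (a i).natTrailingDegree) (by
        obtain ⟨i, hi⟩ := Function.ne_iff.1 ha
        exact ⟨i, by simpa using hi⟩)
    replace hi : a i ≠ 0 := by simpa using hi
    have hdvd : ∀ j, X ^ (a i).natTrailingDegree ∣ a j := fun j => by
      by_cases hj : a j = 0
      · simp [hj]
      · exact X_pow_dvd_iff.2 fun e he => coeff_eq_zero_of_lt_natTrailingDegree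
          (he.trans_le (hmin j (by simpa using hj)))
    choose b hb using hdvd
    refine ⟨b, ?_, i, ?_⟩
    · have h1 : y ^ (a i).natTrailingDegree * ∑ j, aeval y (b j) * x ^ (j : ℕ) = 0 := by
        rw [← h, Finset.mul_sum]
        refine Finset.sum_congr rfl fun j _ => ?_
        conv_rhs => rw [hb j]
        rw [map_mul, map_pow, aeval_X, mul_assoc]
      exact (mul_eq_zero.1 h1).resolve_left (pow_ne_zero _ hy0)
    · have h1 := trailingCoeff_nonzero_iff_nonzero.2 hi
      have h2 := congrArg (fun f => coeff f (a i).natTrailingDegree) (hb i)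
      simp only [coeff_X_pow_mul', le_refl, if_true, Nat.sub_self] at h2
      rwa [trailingCoeff, h2] at h1
  refine ⟨∑ j, C ((b j).coeff 0) * X ^ (j : ℕ), fun h0 => hi ?_, ?_⟩
  · have h1 := congrArg (fun f => coeff f (i : ℕ)) h0
    simpa [finsetSum_coeff, coeff_C_mul, coeff_X_pow, Fin.val_inj] using h1
  · have h1 : aeval x (∑ j, C ((b j).coeff 0) * X ^ (j : ℕ)) =
        ∑ j, -(aeval y (divX (b j)) * x ^ (j : ℕ) * y) := by
      rw [← sub_zero (aeval x _), ← hb, map_sum, ← Finset.sum_sub_distrib]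
      refine Finset.sum_congr rfl fun j _ => ?_
      have h2 := congrArg (aeval y) (divX_mul_X_add (b j))
      rw [map_add, map_mul, aeval_X, aeval_C] at h2
      rw [← h2, map_mul, aeval_C, map_pow, aeval_X]
      ring
    rw [h1]
    refine (P.prime.valuation K).map_sum_lt one_ne_zero fun j _ => ?_
    rw [Valuation.map_neg, map_mul, map_mul, map_pow]
    exact (mul_le_of_le_one_left' (mul_le_one' ((P.prime.valuation K).map_aeval_le_one hy1.le _)
      (pow_le_one' hx _))).trans_lt hy1

end FunctionField

/-- The residue field is algebraic over `F`, by reducing the relations of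
`exists_valuation_aeval_lt_one`. -/
theorem isSquare_residue_mul (F : Type*) [Field F] [Finite F] [Algebra F K]
    [Algebra (RatFunc F) K] [IsScalarTower F (RatFunc F) K] [FunctionField F K] (P : Place K)
    {u w : P.1}
    (hu : ¬ IsSquare (IsLocalRing.residue P.1 u)) (hw : ¬ IsSquare (IsLocalRing.residue P.1 w)) :
    IsSquare (IsLocalRing.residue P.1 (u * w)) := by
  have hmem : ∀ c : F, algebraMap F K c ∈ P.1.toSubring := fun c => by
    rcases eq_or_ne c 0 with rfl | hc
    · rw [map_zero]; exact zero_mem _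
    · exact (P.ord_nonneg_iff ((_root_.map_ne_zero _).2 hc)).1 (P.ord_algebraMap hc).ge
  let : Algebra F P.1 := ((algebraMap F K).codRestrict P.1.toSubring hmem).toAlgebra
  have : IsScalarTower F P.1 K := IsScalarTower.of_algebraMap_eq fun _ => rfl
  have halg : ∀ a : P.1, IsAlgebraic F (IsLocalRing.residue P.1 a) := fun a => by
    obtain ⟨f, hf, h⟩ := P.exists_valuation_aeval_lt_one F (P.prime.valuation_le_one a)
    refine ⟨f, hf, ?_⟩
    rw [aeval_algebraMap_apply, P.prime.valuation_lt_one_iff_mem] at h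
    rw [← IsLocalRing.ResidueField.algebraMap_eq, aeval_algebraMap_apply,
      IsLocalRing.ResidueField.algebraMap_eq, IsLocalRing.residue_eq_zero_iff]
    exact h
  rw [map_mul]
  exact (halg u).isSquare_mul_of_not_isSquare (halg w) hu hw

/-- Hensel's lemma for squares in the completion. -/
theorem isSquare_of_isSquare_residue (P : Place K) {p : ℕ} [Fact p.Prime] [CharP K p] (hp : p ≠ 2)
    {u : P.1} (hu : IsUnit u) (h : IsSquare (IsLocalRing.residue P.1 u)) :
    IsSquare (algebraMap K (P.prime.adicCompletion K) (u : K)) := by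
  obtain ⟨c, hc⟩ := h
  obtain ⟨w, rfl⟩ := IsLocalRing.residue_surjective c
  have hw : IsUnit w := by
    rw [← IsLocalRing.residue_ne_zero_iff_isUnit]
    intro h0
    rw [h0, mul_zero] at hc
    exact (IsLocalRing.residue_ne_zero_iff_isUnit u).2 hu hc
  obtain ⟨w', hw'⟩ := hw.exists_right_inv
  -- Dividing by the square of a lifted root reduces to elements congruent to 1.
  have hmem : u * w' ^ 2 - 1 ∈ IsLocalRing.maximalIdeal P.1 := by
    rw [← IsLocalRing.residue_eq_zero_iff, map_sub, map_mul, map_pow, hc, map_one, sub_eq_zero]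
    have h1 := congrArg (IsLocalRing.residue P.1) hw'
    rw [map_mul, map_one] at h1
    linear_combination (IsLocalRing.residue P.1 w * IsLocalRing.residue P.1 w' + 1) * h1
  have hv : P.prime.valuation K ((u : K) * (w' : K) ^ 2 - 1) < 1 :=
    (P.prime.valuation_lt_one_iff_mem (K := K) (u * w' ^ 2 - 1)).2 hmem
  have : CharP (P.prime.adicCompletion K) p :=
    charP_of_injective_algebraMap (algebraMap K (P.prime.adicCompletion K)).injective p
  have hs : IsSquare (algebraMap K (P.prime.adicCompletion K) ((u : K) * (w' : K) ^ 2)) := by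
    refine Valued.isSquare_of_v_sub_one_lt_one hp ?_
    rw [← map_one (algebraMap K (P.prime.adicCompletion K)), ← map_sub]
    exact (P.prime.valuedAdicCompletion_eq_valuation' _).trans_lt hv
  have hu' : (u : K) = (u : K) * (w' : K) ^ 2 * ((w : K) * (w : K)) := by
    have h1 : (w : K) * (w' : K) = 1 := congrArg Subtype.val hw'
    linear_combination -(u : K) * ((w : K) * (w' : K) + 1) * h1
  rw [hu', map_mul]
  exact hs.mul ((IsSquare.mul_self (w : K)).map _)

theorem exists_eq_unit_mul_sq (P : Place K) {x : Kˣ} (hx : Even (P.ord (x : K))) :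
    ∃ (u : P.1) (z : K), IsUnit u ∧ z ≠ 0 ∧ (x : K) = u * (z * z) := by
  obtain ⟨k, hk⟩ := hx
  obtain ⟨z, hz⟩ := P.prime.valuation_surjective K (WithZero.exp (-k))
  have hz0 : z ≠ 0 := by
    rintro rfl
    rw [map_zero] at hz
    exact WithZero.exp_ne_zero hz.symm
  have hoz : P.ord z = k := by rw [ord, hz, WithZero.log_exp, neg_neg]
  have hy0 : (x : K) * (z * z)⁻¹ ≠ 0 := mul_ne_zero x.ne_zero (inv_ne_zero (mul_ne_zero hz0 hz0))
  have hoy : P.ord ((x : K) * (z * z)⁻¹) = 0 := by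
    rw [P.ord_mul x.ne_zero (inv_ne_zero (mul_ne_zero hz0 hz0)), P.ord_inv, P.ord_mul hz0 hz0]
    omega
  have h1 := (P.ord_nonneg_iff hy0).1 hoy.ge
  have h2 := (P.ord_nonneg_iff (inv_ne_zero hy0)).1 (by rw [P.ord_inv, hoy, neg_zero])
  refine ⟨⟨_, h1⟩, z, IsUnit.of_mul_eq_one ⟨_, h2⟩ (Subtype.ext (mul_inv_cancel₀ hy0)), hz0, ?_⟩
  field_simp

theorem isSquare_of_legendre_eq_one (P : Place K) {x : Kˣ} (h : P.legendre x = 1) :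
    IsSquare (algebraMap K (P.prime.adicCompletion K) (x : K)) := by
  rw [legendre] at h
  by_contra h1
  rw [if_neg h1] at h
  split_ifs at h
  exact zero_ne_one h

theorem not_isSquare_and_even_of_legendre_eq_neg_one (P : Place K) {x : Kˣ}
    (h : P.legendre x = -1) :
    ¬ IsSquare (algebraMap K (P.prime.adicCompletion K) (x : K)) ∧ Even (P.ord (x : K)) := by
  rw [legendre] at h
  split_ifs at h with h1 h2
  exact ⟨h1, Int.not_odd_iff_even.1 h2⟩

theorem legendre_eq_one (P : Place K) {x : Kˣ}
    (h : IsSquare (algebraMap K (P.prime.adicCompletion K) (x : K))) : P.legendre x = 1 :=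
  if_pos h

theorem legendre_eq_one_or_neg_one (P : Place K) {x : Kˣ} (h : Even (P.ord (x : K))) :
    P.legendre x = 1 ∨ P.legendre x = -1 := by
  rw [legendre, if_neg (Int.not_odd_iff_even.2 h)]
  split_ifs <;> simp

/-- Up to squares both elements are units, with nonsquare residues by Hensel; the product of the
residues is a square, which lifts. -/
theorem isSquare_mul_of_legendre_eq_neg_one (F : Type*) [Field F] [Finite F] [Algebra F K]
    [Algebra (RatFunc F) K] [IsScalarTower F (RatFunc F) K] [FunctionField F K]
    (hchar : ringChar F ≠ 2) (P : Place K) {x y : Kˣ} (hx : P.legendre x = -1)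
    (hy : P.legendre y = -1) :
    IsSquare (algebraMap K (P.prime.adicCompletion K) ((x : K) * (y : K))) := by
  have : CharP K (ringChar F) := charP_of_injective_algebraMap (algebraMap F K).injective _
  have : Fact (ringChar F).Prime := ⟨CharP.char_is_prime F _⟩
  have key : ∀ x : Kˣ, P.legendre x = -1 → ∃ (u : P.1) (z : K), IsUnit u ∧
      (x : K) = u * (z * z) ∧ ¬ IsSquare (IsLocalRing.residue P.1 u) := fun x hx => by
    obtain ⟨h1, h2⟩ := P.not_isSquare_and_even_of_legendre_eq_neg_one hx
    obtain ⟨u, z, hu, -, hxu⟩ := P.exists_eq_unit_mul_sq h2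
    refine ⟨u, z, hu, hxu, fun h => h1 ?_⟩
    rw [hxu, map_mul]
    exact (P.isSquare_of_isSquare_residue hchar hu h).mul ((IsSquare.mul_self z).map _)
  obtain ⟨u, z, hu, hxu, hu'⟩ := key x hx
  obtain ⟨w, z', hw, hyw, hw'⟩ := key y hy
  have h := P.isSquare_of_isSquare_residue hchar (hu.mul hw) (P.isSquare_residue_mul F hu' hw')
  have hxy : (x : K) * y = ((u * w : P.1) : K) * ((z * z') * (z * z')) := by
    rw [hxu, hyw]
    push_cast
    ring
  rw [hxy, map_mul]
  exact h.mul ((IsSquare.mul_self (z * z')).map _)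

end Place

end SingularElements

/-! ### Divisors, singular elements and the kernel of ψ -/

namespace SingularElements

theorem ModN.mkQ_eq_zero_iff {G : Type*} [AddCommGroup G] {n : ℕ} {a : G} :
    ModN.mkQ n a = 0 ↔ ∃ z : G, n • z = a := by
  change (LinearMap.range (LinearMap.lsmul ℤ G n)).mkQ a = 0 ↔ _
  rw [Submodule.mkQ_apply, Submodule.Quotient.mk_eq_zero]
  simp

variable {K : Type*} [Field K]

theorem IsSingularBasis.even_ord {n : ℕ} {β : Fin n → Kˣ} (hβ : IsSingularBasis β) (i : Fin n)
    (P : Place K) : Even (P.ord (β i : K)) := by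
  have h : sqClass (β i) ∈ singularClasses (∅ : Set (Place K)) := by
    rw [← hβ.2]
    exact Submodule.subset_span ⟨i, rfl⟩
  obtain ⟨s, hs, hsβ⟩ := h
  have h0 : ModN.mkQ 2 (Additive.ofMul (β i) - s) = 0 := by
    rw [map_sub, hsβ, sqClass, sub_self]
  obtain ⟨z, hz⟩ := ModN.mkQ_eq_zero_iff.1 h0
  have hβs : β i = s.toMul * z.toMul ^ 2 := by
    have := congrArg Additive.toMul (sub_eq_iff_eq_add.1 hz.symm)
    simpa [mul_comm] using this
  rw [hβs, Units.val_mul, P.ord_mul (Units.ne_zero _) (Units.ne_zero _), Units.val_pow_eq_pow_val,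
    P.ord_pow]
  exact (hs P (Set.notMem_empty P)).add (even_two.mul_right _)

theorem divClass_single (P : Place K) (n : ℤ) : divClass (Finsupp.single P n) = n • P.cls := by
  rw [Place.cls, ← map_zsmul, Finsupp.smul_single, smul_eq_mul, mul_one]

theorem divClass_latticeDivisor {t m : ℕ} (p : Place K) (T : Fin t → Place K)
    (b : Fin m → Place K) (v : Fin (1 + t + m) → ℤ) :
    divClass (latticeDivisor p T b v) = psi p T b v := by
  rw [latticeDivisor, map_add, map_add, map_sum, map_sum]
  simp only [divClass_single]
  rfl

theorem exists_ord_eq_of_divClass_eq_zero {D : Divisor K} (h : divClass D = 0) :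
    ∃ x : Kˣ, ∀ P : Place K, D P = P.ord (x : K) :=
  (QuotientAddGroup.eq_zero_iff D).1 h

theorem even_sum_single_two_mul {m : ℕ} (b : Fin m → Place K) (c : Fin m → ℤ) (q : Place K) :
    Even ((∑ i, Finsupp.single (b i) (2 * c i)) q) := by
  classical
  rw [Finsupp.finsetSum_apply]
  refine Finset.even_sum _ fun i _ => ?_
  rw [Finsupp.single_apply]
  split_ifs
  exacts [even_two.mul_right _, Even.zero]

/-- Only parity is claimed since `p` or `q` may be one of the `b i`, whose coefficients are even. -/
theorem even_latticeDivisor_sub_single {t m : ℕ} (p : Place K) {T : Fin t → Place K}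
    (b : Fin m → Place K) (v : Fin (1 + t + m) → ℤ) {q : Place K} (hq : q ∉ Set.range T) :
    Even (latticeDivisor p T b v q - Finsupp.single p (coordP v) q) := by
  classical
  have hT : (∑ i, Finsupp.single (T i) (coordT v i)) q = 0 := by
    rw [Finsupp.finsetSum_apply]
    exact Finset.sum_eq_zero fun i _ => Finsupp.single_eq_of_ne fun h => hq ⟨i, h.symm⟩
  rw [latticeDivisor, Finsupp.add_apply, Finsupp.add_apply, hT, add_zero, add_sub_cancel_left]
  exact even_sum_single_two_mul _ _ _

theorem riemannRoch_eq_span {F : Type*} [Field F] [Finite F] [Algebra F K]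
    [Algebra (RatFunc F) K] [IsScalarTower F (RatFunc F) K] [FunctionField F K]
    (hF : algebraicClosure F K = ⊥) {D : Divisor K} {x : Kˣ}
    (hD : ∀ P : Place K, D P = P.ord (x : K)) :
    riemannRoch F D = Submodule.span F {(x : K)⁻¹} := by
  apply le_antisymm
  · intro y hy
    by_contra hcon
    have hy0 : y ≠ 0 := fun h => hcon (h ▸ zero_mem _)
    obtain ⟨P, hP⟩ := exists_place_ord_neg hF (x := y * x) (by
      rintro ⟨c, hc⟩
      refine hcon (Submodule.mem_span_singleton.2 ⟨c, ?_⟩)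
      rw [Algebra.smul_def, hc, mul_inv_cancel_right₀ x.ne_zero])
    rw [P.ord_mul hy0 x.ne_zero, ← hD] at hP
    have := hy hy0 P
    omega
  · rw [Submodule.span_singleton_le_iff_mem]
    intro _ P
    rw [P.ord_inv, hD]

theorem ord_eq_of_span_eq {F : Type*} [Field F] [Finite F] [Algebra F K] {x y : Kˣ}
    (h : Submodule.span F {(x : K)} = Submodule.span F {(y : K)}) (P : Place K) :
    P.ord (x : K) = P.ord (y : K) := by
  obtain ⟨c, hc⟩ := Submodule.mem_span_singleton.1 (h ▸ Submodule.mem_span_singleton_self (x : K))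
  have hc0 : c ≠ 0 := by
    rintro rfl
    rw [zero_smul] at hc
    exact x.ne_zero hc.symm
  rw [← hc, Algebra.smul_def, P.ord_mul ((_root_.map_ne_zero _).2 hc0) y.ne_zero,
    P.ord_algebraMap hc0, zero_add]

theorem even_ord_prod_pow {n : ℕ} {β : Fin n → Kˣ} (hβ : IsSingularBasis β) (e : Fin n → ℕ)
    (P : Place K) : Even (P.ord ((∏ i, β i ^ e i : Kˣ) : K)) := by
  have : ∏ i, β i ^ e i ∈ singularUnits (∅ : Set (Place K)) :=
    Subgroup.prod_mem _ fun i _ => 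
      Subgroup.pow_mem (singularUnits ∅) (fun P _ => hβ.even_ord i P : β i ∈ singularUnits ∅) _
  exact this P (Set.notMem_empty P)

/-- At `b j` every `β i` with `i ≠ j` is a square; `β j` enters exactly when `l` is a nonsquare of
even order there. -/
theorem legendre_mul_prod_eq_one (F : Type*) [Field F] [Finite F] [Algebra F K]
    [Algebra (RatFunc F) K] [IsScalarTower F (RatFunc F) K] [FunctionField F K]
    (hchar : ringChar F ≠ 2) {n : ℕ} {β : Fin n → Kˣ} {b : Fin n → Place K}
    (hβb : Compatible β b) {l : Kˣ} {e : Fin n → Fin 2}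
    (he : ∀ i, (-1 : ℤ) ^ (e i : ℕ) = (b i).legendre l) (j : Fin n) :
    (b j).legendre (l * ∏ i, β i ^ (e i : ℕ)) = 1 := by
  apply Place.legendre_eq_one
  rw [← Finset.mul_prod_erase _ _ (Finset.mem_univ j), ← mul_assoc, Units.val_mul, map_mul]
  refine IsSquare.mul ?_ ?_
  · have hj := he j
    rcases Fin.exists_fin_two.1 ⟨e j, rfl⟩ with h | h
    · rw [h] at hj ⊢
      simpa using Place.isSquare_of_legendre_eq_one _ hj.symm
    · rw [h] at hj ⊢
      simpa using Place.isSquare_mul_of_legendre_eq_neg_one F hchar (b j) hj.symm (hβb.1 j)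
  · rw [Units.coe_prod, map_prod]
    refine Finset.isSquare_prod _ fun i hi => ?_
    rw [Units.val_pow_eq_pow_val, map_pow]
    exact (Place.isSquare_of_legendre_eq_one _ (hβb.2 i j (Finset.ne_of_mem_erase hi))).pow _

theorem sum_smul_clsModTwo_eq {s t : ℕ} {S' : Fin s → Place K} (hS' : Function.Injective S')
    {ε : Fin s → ZMod 2} {T : Fin t → Place K} (hT : Function.Injective T)
    (hTS : Set.range T = S' '' {i | ε i = 1}) :
    ∑ i, ε i • (S' i).clsModTwo = ∑ i, (T i).clsModTwo := by
  classical
  have himg : Finset.univ.image T = (Finset.univ.filter fun i => ε i = 1).image S' := by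
    apply Finset.coe_injective
    simpa using hTS
  rw [← Finset.sum_image (f := Place.clsModTwo) (s := Finset.univ) (g := T) hT.injOn, himg,
    Finset.sum_image hS'.injOn, Finset.sum_filter]
  refine Finset.sum_congr rfl fun i _ => ?_
  split_ifs with h
  · rw [h, one_smul]
  · have h0 : ε i = 0 := by
      revert h
      generalize ε i = c
      revert c
      decide
    rw [h0, zero_smul]

theorem exists_mem_ker_psi {t m : ℕ} {p : Place K} {T : Fin t → Place K} {b : Fin m → Place K}
    (hgen : AddSubgroup.closure (Set.range fun i => (b i).cls) = ⊤)
    (h : p.clsModTwo = ∑ i, (T i).clsModTwo) :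
    ∃ v ∈ LinearMap.ker (psi p T b), coordP v = 1 := by
  have h0 : ModN.mkQ 2 (p.cls - ∑ i, (T i).cls) = 0 := by
    rw [map_sub, map_sum, sub_eq_zero]
    exact h
  obtain ⟨z, hz⟩ := ModN.mkQ_eq_zero_iff.1 h0
  have hz' : z ∈ Submodule.span ℤ (Set.range fun i => (b i).cls) := by
    rw [← Submodule.mem_toAddSubgroup, Submodule.span_int_eq_addSubgroupClosure, hgen]
    trivial
  obtain ⟨k, hk⟩ := (Submodule.mem_span_range_iff_exists_fun ℤ).1 hz'
  -- These coordinates encode `[𝔭] - ∑ [𝔱ᵢ] - 2z = 0` with `z = ∑ kᵢ[𝔟ᵢ]`.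
  refine ⟨Fin.append (Fin.append (fun _ => 1) (fun _ => -1)) (fun i => -k i), ?_, ?_⟩
  · rw [LinearMap.mem_ker]
    simp only [psi, LinearMap.coe_mk, AddHom.coe_mk, coordP, coordT, coordB, Fin.append_left,
      Fin.append_right, one_smul, neg_smul, Finset.sum_neg_distrib, mul_smul]
    rw [← Finset.smul_sum, Finset.sum_neg_distrib, hk, ← sub_eq_add_neg, ← hz, smul_neg,
      ← natCast_zsmul]
    exact add_neg_cancel _
  · simp [coordP]

end SingularElements

theorem mainTheorem5
    {F K : Type*} [Field F] [Finite F] [Field K] [Algebra F K]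
    [Algebra (RatFunc F) K] [IsScalarTower F (RatFunc F) K] [FunctionField F K]
    (hF : algebraicClosure F K = ⊥) (hchar : ringChar F ≠ 2)
    {n m s : ℕ} (hnm : n ≤ m)
    (β : Fin n → Kˣ) (b : Fin m → Place K) (hb : Function.Injective b)
    (hβ : IsSingularBasis β)
    (hβb : Compatible β (fun i => b (Fin.castLE hnm i)))
    (hgen : AddSubgroup.closure (Set.range fun i => (b i).cls) = ⊤)
    (S' : Fin s → Place K)
    (hS'b : Disjoint (Set.range S') (Set.range b))
    (hS' : LinearIndependent (ZMod 2) (fun i => (S' i).clsModTwo))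
    (p : Place K) (hpS' : p ∉ Set.range S')
    (hpB : p ∉ Set.range fun i => b (Fin.castLE hnm i))
    (hp : p.clsModTwo ∈ Submodule.span (ZMod 2) (Set.range fun i => (S' i).clsModTwo)) :
    (∃ ε : Fin s → ZMod 2, p.clsModTwo = ∑ i, ε i • (S' i).clsModTwo) ∧
    ∀ ε : Fin s → ZMod 2, p.clsModTwo = ∑ i, ε i • (S' i).clsModTwo →
      ∀ (t : ℕ) (T : Fin t → Place K), Function.Injective T →
        Set.range T = S' '' {i | ε i = 1} →
        (∃ v ∈ LinearMap.ker (psi p T b), coordP v ≡ 1 [ZMOD 2]) ∧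
        ∀ v ∈ LinearMap.ker (psi p T b), coordP v ≡ 1 [ZMOD 2] →
          Module.finrank F (riemannRoch F (latticeDivisor p T b v)) = 1 ∧
          ∀ l : Kˣ, Submodule.span F {(l : K)} = riemannRoch F (latticeDivisor p T b v) →
            ∃ e : Fin n → Fin 2,
              (∀ i, (-1 : ℤ) ^ (e i : ℕ) = (b (Fin.castLE hnm i)).legendre l) ∧
              IsLambda (Set.range S') (Set.range fun i => b (Fin.castLE hnm i)) p
                (l * ∏ i, β i ^ (e i : ℕ)) := by
  refine ⟨?_, fun ε hε t T hT hTS => ⟨?_, fun v hv hv0 => ?_⟩⟩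
  · obtain ⟨ε, hε⟩ := (Submodule.mem_span_range_iff_exists_fun (ZMod 2)).1 hp
    exact ⟨ε, hε.symm⟩
  · have hinj : Function.Injective S' := fun i j hij => hS'.injective (by simp only [hij])
    obtain ⟨v, hv, hv0⟩ := exists_mem_ker_psi (T := T) hgen
      (hε.trans (sum_smul_clsModTwo_eq hinj hT hTS))
    exact ⟨v, hv, by rw [hv0]⟩
  · have hTS' : ∀ q, q ∉ Set.range S' → q ∉ Set.range T := fun q hq h => hq (by
      rw [hTS] at h
      exact Set.image_subset_range _ _ h)
    obtain ⟨x, hx⟩ := exists_ord_eq_of_divClass_eq_zero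
      ((divClass_latticeDivisor p T b v).trans (LinearMap.mem_ker.1 hv))
    rw [riemannRoch_eq_span hF hx]
    refine ⟨finrank_span_singleton (inv_ne_zero x.ne_zero), fun l hl => ?_⟩
    have hord : ∀ P : Place K, P.ord (l : K) = -latticeDivisor p T b v P := fun P => by
      rw [← Units.val_inv_eq_inv_val] at hl
      rw [ord_eq_of_span_eq hl, Units.val_inv_eq_inv_val, P.ord_inv, hx]
    have heven : ∀ q, q ∉ Set.range S' → q ≠ p → Even (q.ord (l : K)) := fun q hq hqp => by
      have := even_latticeDivisor_sub_single p b v (hTS' q hq)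
      rw [Finsupp.single_eq_of_ne hqp, sub_zero] at this
      rw [hord]
      exact this.neg
    -- Places of `B` avoid `S'` and `p`, so the symbol of `l` there is never 0 and `e` exists.
    have hlB : ∀ i : Fin n, Even ((b (Fin.castLE hnm i)).ord (l : K)) := fun i =>
      heven _ (fun h => Set.disjoint_left.1 hS'b h ⟨_, rfl⟩) fun h => hpB ⟨i, h⟩
    have hex : ∀ i : Fin n, ∃ c : Fin 2,
        (-1 : ℤ) ^ (c : ℕ) = (b (Fin.castLE hnm i)).legendre l := fun i => by
      rcases Place.legendre_eq_one_or_neg_one _ (hlB i) with h | h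
      · exact ⟨0, by simp [h]⟩
      · exact ⟨1, by simp [h]⟩
    choose e he using hex
    have hprod := even_ord_prod_pow hβ fun i => (e i : ℕ)
    refine ⟨e, he, ?_, ?_, ?_⟩
    · intro q hq
      rw [Units.val_mul, q.ord_mul l.ne_zero (Units.ne_zero _)]
      exact (heven q (fun h => hq (.inl h)) fun h => hq (.inr h)).add (hprod q)
    · rw [Units.val_mul, p.ord_mul l.ne_zero (Units.ne_zero _), hord]
      have h1 := even_latticeDivisor_sub_single p b v (hTS' p hpS')
      rw [Finsupp.single_eq_same] at h1
      obtain ⟨c, hc⟩ := h1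
      obtain ⟨d, hd⟩ := hprod p
      rw [hd]
      have := hv0
      unfold Int.ModEq at this ⊢
      omega
    · rintro _ ⟨j, rfl⟩
      exact legendre_mul_prod_eq_one F hchar hβb he j
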